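/- Let $0<I_z<I_y<I_x$ be the moments of inertia of an asymmetric rigid body, and put $$a=\frac{I_y}{I_z}-1,\qquad b=1-\frac{I_y}{I_x},\qquad \mathcal I=\frac{1-b}{\sqrt{b(a+b)}},$$ so that $a>0$ and $0<b<1$. The body is called physical if $I_y+I_z\ge I_x$. Consider the reduced system $$\frac{d\psi}{d\phi}=\frac{(a+b\cos^2\psi)\cos\theta}{1-b\cos^2\psi},\qquad \frac{d\theta}{d\phi}=\frac{b\sin\theta\sin\psi\cos\psi}{1-b\cos^2\psi},$$ with first integral $c=a-\sin^2\theta\,(a+b\cos^2\psi)$. Let $\mathcal C$ be the set of pairs $(c,\varepsilon)\in\mathbb R^2$ for which there is a solution $(\psi,\theta)$ on $\phi\in[0,2\pi]$, on which the first integral has the value $c$, such that $\psi(0)=-\frac{\pi}{2}+\varepsilon$ and $\psi(2\pi)=\frac{\pi}{2}-\varepsilon$, and such that the trajectory is traversed symmetrically: at half time $\psi(\pi)=0$ and $\cos\theta(\pi)\ge 0$ (so that $\psi$ is increasing there, except at the equilibrium $c=-b$). Theorem. The set $\mathcal C$ is the graph of a function $c\mapsto\varepsilon(c)$ on $[-b,a]$.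 This function is injective if and only if $\mathcal I\ge 1$, and likewise its restriction to the open interval $(-b,a)$ is injective if and only if $\mathcal I\ge1$. Moreover $\mathcal I\ge 1$ if and only if the rigid body is physical. -/

import Mathlib

/-- The first asymmetry parameter `a = I_y / I_z - 1` of a rigid body. -/
noncomputable def asymmetryA (Iy Iz : ℝ) : ℝ := Iy / Iz - 1

/-- The second asymmetry parameter `b = 1 - I_y / I_x` of a rigid body. -/
noncomputable def asymmetryB (Ix Iy : ℝ) : ℝ := 1 - Iy / Ix

/-- A rigid body with `I_z < I_y < I_x` is physical if `I_y + I_z ≥ I_x`. -/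
def IsPhysical (Ix Iy Iz : ℝ) : Prop := Iy + Iz ≥ Ix

/-- The geometric constant `(1 - b) / √(b (a + b))`. -/
noncomputable def geometricConstant (a b : ℝ) : ℝ := (1 - b) / √(b * (a + b))

/-- `(ψ, θ)`, as functions of the angle `φ ∈ [0, 2π]`, is a trajectory of the reduced system
of the free rigid body on which the first integral `a - sin² θ (a + b cos² ψ)` has the value `c`. -/
structure IsReducedTrajectory (a b c : ℝ) (ψ θ : ℝ → ℝ) : Prop where
  deriv_psi : ∀ φ ∈ Set.Icc 0 (2 * Real.pi),
    HasDerivWithinAt ψ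
      ((a + b * Real.cos (ψ φ) ^ 2) * Real.cos (θ φ) / (1 - b * Real.cos (ψ φ) ^ 2))
      (Set.Icc 0 (2 * Real.pi)) φ
  deriv_theta : ∀ φ ∈ Set.Icc 0 (2 * Real.pi),
    HasDerivWithinAt θ
      (b * Real.sin (θ φ) * Real.sin (ψ φ) * Real.cos (ψ φ) / (1 - b * Real.cos (ψ φ) ^ 2))
      (Set.Icc 0 (2 * Real.pi)) φ
  first_integral : ∀ φ ∈ Set.Icc 0 (2 * Real.pi),
    a - Real.sin (θ φ) ^ 2 * (a + b * Real.cos (ψ φ) ^ 2) = c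

/-- The curve of the pairs `(c, ε)` such that the trajectory of parameter `c` goes from
`ψ = -π/2 + ε` to `ψ = π/2 - ε` while `φ` increases by `2π`. The trajectory is traversed
symmetrically: at half time it crosses `ψ = 0`, in the direction of increasing `ψ` (`cos θ > 0`;
`cos θ = 0` there only at the equilibrium `c = -b`). This fixes the sign of `cos θ`, which the
first integral leaves open; before and after the half time `cos θ` may change sign. -/
def tennisRacketCurve (a b : ℝ) : Set (ℝ × ℝ) :=
  {p | ∃ ψ θ : ℝ → ℝ, IsReducedTrajectory a b p.1 ψ θ ∧
    ψ 0 = -(Real.pi / 2) + p.2 ∧ ψ (2 * Real.pi) = Real.pi / 2 - p.2 ∧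
    ψ Real.pi = 0 ∧ 0 ≤ Real.cos (θ Real.pi)}

/-! With `x = √b sin ψ` and `y = cos θ √(a + b cos² ψ)` the first integral reads `x² + y² = c + b`,
and the flow rotates `(x, y)` with angular speed `angularSpeed a b (cos ψ)`. Adding the polar angle
`u`, measured from the `y`-axis, to the unknowns gives a globally Lipschitz system, with `√b sin ψ =
√(c + b) sin u` when `ψ = u = 0` at time `π`. By uniqueness and time reversal, each `c` in `[-b, a]`
gives exactly one `ε = π/2 - ψ(2π)`.

The angular speed increases with `cos ψ`, and its maximum, at `ψ = 0`, is the reciprocal of the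
geometric constant.

If this maximum is at most 1, `ψ(2π)` is strictly increasing in `c` (`psi_lt_psi`). Where two
trajectories with `c₁ < c₂` meet, the second has the larger `cos² θ`, hence the larger `ψ'`,
provided its `cos θ` is nonnegative. For `c₂ ≥ 0` the angle `u₂` never leaves `(-π/2, π/2)`. For `c₂
< 0` an obtuse `u₂ ≤ u₁ ≤ π` would contradict `√(c₁ + b) sin u₁ = √(c₂ + b) sin u₂`.

If the maximum exceeds 1, `u(2π)` is above `π` at `c = -b` and below `π/2` at `c = 0`. By continuity
it equals `π` for some `c` between, where `ψ(2π) = 0` as at the equilibrium (`exists_psi_eq_zero`),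
and injectivity fails. -/

open Set Metric
open scoped NNReal

/-! ### The lifted system: global flow and uniqueness -/

/-- The reduced vector field in the coordinates `(ψ, θ)`, extended by the speed of the polar angle
of the point `(√b sin ψ, cos θ √(a + b cos² ψ))`. -/
noncomputable def liftedField (a b : ℝ) (w : ℝ × ℝ × ℝ) : ℝ × ℝ × ℝ :=
  ((a + b * Real.cos w.1 ^ 2) * Real.cos w.2.1 / (1 - b * Real.cos w.1 ^ 2),
    b * Real.sin w.2.1 * Real.sin w.1 * Real.cos w.1 / (1 - b * Real.cos w.1 ^ 2),
    √b * Real.cos w.1 * √(a + b * Real.cos w.1 ^ 2) / (1 - b * Real.cos w.1 ^ 2))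

/-- `w` is an integral curve of the lifted field on `[0, 2π]`. -/
def IsLiftedTrajectory (a b : ℝ) (w : ℝ → ℝ × ℝ × ℝ) : Prop :=
  ∀ φ ∈ Icc 0 (2 * Real.pi),
    HasDerivWithinAt w (liftedField a b (w φ)) (Icc 0 (2 * Real.pi)) φ

/-- The trigonometric coordinates through which the lifted field factors. -/
noncomputable def trigCoordinates (w : ℝ × ℝ × ℝ) : ℝ × ℝ × ℝ × ℝ :=
  (Real.cos w.1, Real.sin w.1, Real.cos w.2.1, Real.sin w.2.1)

/-- The lifted field in trigonometric coordinates. -/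
noncomputable def trigField (a b : ℝ) (z : ℝ × ℝ × ℝ × ℝ) : ℝ × ℝ × ℝ :=
  ((a + b * z.1 ^ 2) * z.2.2.1 / (1 - b * z.1 ^ 2),
    b * z.2.2.2 * z.2.1 * z.1 / (1 - b * z.1 ^ 2),
    √b * z.1 * √(a + b * z.1 ^ 2) / (1 - b * z.1 ^ 2))

theorem lipschitzWith_trigCoordinates : LipschitzWith 1 trigCoordinates := by
  have h1 : LipschitzWith 1 (fun w : ℝ × ℝ × ℝ => w.1) := LipschitzWith.prod_fst
  have h2 : LipschitzWith 1 (fun w : ℝ × ℝ × ℝ => w.2.1) := by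
    simpa using! LipschitzWith.prod_fst.comp
      (LipschitzWith.prod_snd : LipschitzWith 1 (Prod.snd : ℝ × ℝ × ℝ → ℝ × ℝ))
  have hc : LipschitzWith 1 Real.cos := Real.lipschitzWith_cos
  have hs : LipschitzWith 1 Real.sin := Real.lipschitzWith_sin
  have := (hc.comp h1).prodMk ((hs.comp h1).prodMk ((hc.comp h2).prodMk (hs.comp h2)))
  simpa [trigCoordinates] using! this

theorem trigCoordinates_mem (w : ℝ × ℝ × ℝ) :
    trigCoordinates w ∈ Icc (-1 : ℝ) 1 ×ˢ Icc (-1 : ℝ) 1 ×ˢ Icc (-1 : ℝ) 1 ×ˢ Icc (-1 : ℝ) 1 :=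
  ⟨Real.cos_mem_Icc _, Real.sin_mem_Icc _, Real.cos_mem_Icc _, Real.sin_mem_Icc _⟩

theorem one_sub_mul_sq_pos {b x : ℝ} (hb0 : 0 < b) (hb1 : b < 1) (hx : x ^ 2 ≤ 1) :
    0 < 1 - b * x ^ 2 := by
  nlinarith

theorem contDiffOn_trigField {a b : ℝ} (ha : 0 < a) (hb0 : 0 < b) (hb1 : b < 1) :
    ContDiffOn ℝ 1 (trigField a b)
      (Icc (-1 : ℝ) 1 ×ˢ Icc (-1 : ℝ) 1 ×ˢ Icc (-1 : ℝ) 1 ×ˢ Icc (-1 : ℝ) 1) := by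
  have hD : ∀ z ∈ Icc (-1 : ℝ) 1 ×ˢ Icc (-1 : ℝ) 1 ×ˢ Icc (-1 : ℝ) 1 ×ˢ Icc (-1 : ℝ) 1,
      1 - b * z.1 ^ 2 ≠ 0 := fun z hz =>
    (one_sub_mul_sq_pos hb0 hb1 (by nlinarith [hz.1.1, hz.1.2])).ne'
  have hS : ∀ z ∈ Icc (-1 : ℝ) 1 ×ˢ Icc (-1 : ℝ) 1 ×ˢ Icc (-1 : ℝ) 1 ×ˢ Icc (-1 : ℝ) 1,
      a + b * z.1 ^ 2 ≠ 0 := fun z _ => by positivity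
  unfold trigField
  refine ContDiffOn.prodMk ?_ (ContDiffOn.prodMk ?_ ?_)
  · exact ContDiffOn.div (by fun_prop) (by fun_prop) hD
  · exact ContDiffOn.div (by fun_prop) (by fun_prop) hD
  · refine ContDiffOn.div (ContDiffOn.mul (by fun_prop) (ContDiffOn.sqrt (by fun_prop) hS))
      (by fun_prop) hD

/-- The field factors through a compact convex cube on which `trigField` is `C¹`, hence Lipschitz.
-/
theorem exists_lipschitzWith_liftedField {a b : ℝ} (ha : 0 < a) (hb0 : 0 < b) (hb1 : b < 1) :
    ∃ K, LipschitzWith K (liftedField a b) := by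
  obtain ⟨K, hK⟩ := (contDiffOn_trigField ha hb0 hb1).exists_lipschitzOnWith one_ne_zero
    ((convex_Icc _ _).prod ((convex_Icc _ _).prod ((convex_Icc _ _).prod (convex_Icc _ _))))
    (isCompact_Icc.prod (isCompact_Icc.prod (isCompact_Icc.prod isCompact_Icc)))
  have := hK.comp (lipschitzWith_trigCoordinates.lipschitzOnWith (s := univ))
    (fun w _ => trigCoordinates_mem w)
  exact ⟨K * 1, lipschitzOnWith_univ.1 this⟩

theorem exists_norm_liftedField_le {a b : ℝ} (ha : 0 < a) (hb0 : 0 < b) (hb1 : b < 1) :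
    ∃ M : ℝ≥0, ∀ w, ‖liftedField a b w‖ ≤ M := by
  obtain ⟨M, hM⟩ := (isCompact_Icc.prod (isCompact_Icc.prod (isCompact_Icc.prod
    isCompact_Icc))).exists_bound_of_continuousOn (contDiffOn_trigField ha hb0 hb1).continuousOn
  exact ⟨M.toNNReal, fun w => (hM _ (trigCoordinates_mem w)).trans (Real.le_coe_toNNReal M)⟩

theorem exists_liftedFlow {a b : ℝ} (ha : 0 < a) (hb0 : 0 < b) (hb1 : b < 1) (r : ℝ≥0) :
    ∃ α : ℝ × ℝ × ℝ → ℝ → ℝ × ℝ × ℝ,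
      (∀ x ∈ closedBall 0 (r : ℝ), α x Real.pi = x ∧ IsLiftedTrajectory a b (α x)) ∧
      ∃ K : ℝ≥0, ∀ φ ∈ Icc 0 (2 * Real.pi), LipschitzOnWith K (α · φ) (closedBall 0 r) := by
  obtain ⟨K, hK⟩ := exists_lipschitzWith_liftedField ha hb0 hb1
  obtain ⟨M, hM⟩ := exists_norm_liftedField_le ha hb0 hb1
  have hpi := Real.pi_pos
  -- The field is bounded by `M`, so in time at most `π` on either side of the midpoint no solution
  -- moves farther than `M π`.
  have hP : IsPicardLindelof (fun _ : ℝ => liftedField a b)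
      (⟨Real.pi, by constructor <;> linarith⟩ : Icc 0 (2 * Real.pi)) 0
      (r + M * Real.pi.toNNReal) r M K :=
    { lipschitzOnWith := fun _ _ => hK.lipschitzOnWith
      continuousOn := fun _ _ => continuousOn_const
      norm_le := fun _ _ x _ => hM x
      mul_max_le := by
        simp only [NNReal.coe_add, NNReal.coe_mul, Real.coe_toNNReal _ hpi.le]
        rw [show 2 * Real.pi - Real.pi = Real.pi by ring, sub_zero, max_self]
        linarith }
  exact hP.exists_forall_mem_closedBall_eq_hasDerivWithinAt_lipschitzOnWith

theorem IsLiftedTrajectory.eqOn {a b : ℝ} (ha : 0 < a) (hb0 : 0 < b) (hb1 : b < 1)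
    {w₁ w₂ : ℝ → ℝ × ℝ × ℝ} (h₁ : IsLiftedTrajectory a b w₁) (h₂ : IsLiftedTrajectory a b w₂)
    {τ : ℝ} (hτ : τ ∈ Icc 0 (2 * Real.pi)) (h : w₁ τ = w₂ τ) :
    EqOn w₁ w₂ (Icc 0 (2 * Real.pi)) := by
  obtain ⟨K, hK⟩ := exists_lipschitzWith_liftedField ha hb0 hb1
  have hc : ∀ {w}, IsLiftedTrajectory a b w → ContinuousOn w (Icc 0 (2 * Real.pi)) :=
    fun hw => HasDerivWithinAt.continuousOn hw
  have hr : Icc τ (2 * Real.pi) ⊆ Icc 0 (2 * Real.pi) := Icc_subset_Icc_left hτ.1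
  have hl : Icc 0 τ ⊆ Icc 0 (2 * Real.pi) := Icc_subset_Icc_right hτ.2
  have hdr : ∀ {w}, IsLiftedTrajectory a b w → ∀ t ∈ Ico τ (2 * Real.pi),
      HasDerivWithinAt w (liftedField a b (w t)) (Ici t) t := fun hw t ht =>
    (hw t (hr ⟨ht.1, ht.2.le⟩)).mono_of_mem_nhdsWithin
      (Filter.mem_of_superset (Icc_mem_nhdsGE ht.2) (Icc_subset_Icc_left (hτ.1.trans ht.1)))
  have hdl : ∀ {w}, IsLiftedTrajectory a b w → ∀ t ∈ Ioc 0 τ,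
      HasDerivWithinAt w (liftedField a b (w t)) (Iic t) t := fun hw t ht =>
    (hw t (hl ⟨ht.1.le, ht.2⟩)).mono_of_mem_nhdsWithin
      (Filter.mem_of_superset (Icc_mem_nhdsLE ht.1) (Icc_subset_Icc_right (ht.2.trans hτ.2)))
  intro t ht
  rcases le_total τ t with h' | h'
  · exact ODE_solution_unique_of_mem_Icc_right (v := fun _ => liftedField a b)
      (s := fun _ => univ) (K := K) (fun _ _ => hK.lipschitzOnWith) ((hc h₁).mono hr) (hdr h₁)
      (fun _ _ => trivial) ((hc h₂).mono hr) (hdr h₂) (fun _ _ => trivial) h ⟨h', ht.2⟩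
  · exact ODE_solution_unique_of_mem_Icc_left (v := fun _ => liftedField a b)
      (s := fun _ => univ) (K := K) (fun _ _ => hK.lipschitzOnWith) ((hc h₁).mono hl) (hdl h₁)
      (fun _ _ => trivial) ((hc h₂).mono hl) (hdl h₂) (fun _ _ => trivial) h ⟨ht.1, h'⟩

/-! ### Centred trajectories in polar coordinates -/

/-- A lifted trajectory that crosses `ψ = 0` at half time with polar angle `0` and with `θ` the
angle in `[0, π/2]` for which, if `-b ≤ c ≤ a`, the first integral has the value `c`. -/
structure IsCentredTrajectory (a b c : ℝ) (w : ℝ → ℝ × ℝ × ℝ) : Prop where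
  lifted : IsLiftedTrajectory a b w
  initial : w Real.pi = (0, Real.arccos √((c + b) / (a + b)), 0)

theorem pi_mem_Icc : Real.pi ∈ Icc 0 (2 * Real.pi) :=
  ⟨Real.pi_pos.le, by linarith [Real.pi_pos]⟩

namespace IsLiftedTrajectory

variable {a b : ℝ} {w : ℝ → ℝ × ℝ × ℝ} {φ : ℝ}

theorem hasDerivWithinAt_psi (hw : IsLiftedTrajectory a b w) (hφ : φ ∈ Icc 0 (2 * Real.pi)) :
    HasDerivWithinAt (fun t => (w t).1)
      ((a + b * Real.cos (w φ).1 ^ 2) * Real.cos (w φ).2.1 / (1 - b * Real.cos (w φ).1 ^ 2))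
      (Icc 0 (2 * Real.pi)) φ :=
  (hw φ hφ).fst

theorem hasDerivWithinAt_theta (hw : IsLiftedTrajectory a b w) (hφ : φ ∈ Icc 0 (2 * Real.pi)) :
    HasDerivWithinAt (fun t => (w t).2.1)
      (b * Real.sin (w φ).2.1 * Real.sin (w φ).1 * Real.cos (w φ).1 /
        (1 - b * Real.cos (w φ).1 ^ 2))
      (Icc 0 (2 * Real.pi)) φ :=
  (hw φ hφ).snd.fst

theorem hasDerivWithinAt_angle (hw : IsLiftedTrajectory a b w) (hφ : φ ∈ Icc 0 (2 * Real.pi)) :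
    HasDerivWithinAt (fun t => (w t).2.2)
      (√b * Real.cos (w φ).1 * √(a + b * Real.cos (w φ).1 ^ 2) / (1 - b * Real.cos (w φ).1 ^ 2))
      (Icc 0 (2 * Real.pi)) φ :=
  (hw φ hφ).snd.snd

theorem continuousOn (hw : IsLiftedTrajectory a b w) : ContinuousOn w (Icc 0 (2 * Real.pi)) :=
  HasDerivWithinAt.continuousOn hw

/-- This and the next lemma say `x' = y u'` and `y' = -x u'`: the point `(x, y)` turns rigidly about
the origin. -/
theorem hasDerivWithinAt_abscissa (hb0 : 0 < b) (hw : IsLiftedTrajectory a b w)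
    (ha : 0 < a) (hφ : φ ∈ Icc 0 (2 * Real.pi)) :
    HasDerivWithinAt (fun t => √b * Real.sin (w t).1)
      (Real.cos (w φ).2.1 * √(a + b * Real.cos (w φ).1 ^ 2) *
        (liftedField a b (w φ)).2.2) (Icc 0 (2 * Real.pi)) φ := by
  refine ((hw.hasDerivWithinAt_psi hφ).sin.const_mul √b).congr_deriv ?_
  have hS : √(a + b * Real.cos (w φ).1 ^ 2) ^ 2 = a + b * Real.cos (w φ).1 ^ 2 :=
    Real.sq_sqrt (by positivity)
  simp only [liftedField]
  rw [← hS]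
  simp only [Real.sqrt_sq (Real.sqrt_nonneg _)]
  ring

theorem hasDerivWithinAt_ordinate (hb0 : 0 < b) (hw : IsLiftedTrajectory a b w)
    (ha : 0 < a) (hφ : φ ∈ Icc 0 (2 * Real.pi)) :
    HasDerivWithinAt (fun t => Real.cos (w t).2.1 * √(a + b * Real.cos (w t).1 ^ 2))
      (-(√b * Real.sin (w φ).1) * (liftedField a b (w φ)).2.2) (Icc 0 (2 * Real.pi)) φ := by
  have hpos : 0 < a + b * Real.cos (w φ).1 ^ 2 := by positivity
  refine ((hw.hasDerivWithinAt_theta hφ).cos.mul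
    ((((hw.hasDerivWithinAt_psi hφ).cos.pow 2).const_mul b |>.const_add a).sqrt
      hpos.ne')).congr_deriv ?_
  have hS : √(a + b * Real.cos (w φ).1 ^ 2) ^ 2 = a + b * Real.cos (w φ).1 ^ 2 :=
    Real.sq_sqrt hpos.le
  have hS0 : √(a + b * Real.cos (w φ).1 ^ 2) ≠ 0 := (Real.sqrt_pos.2 hpos).ne'
  have hb : √b ^ 2 = b := Real.sq_sqrt hb0.le
  have hθ : Real.sin (w φ).2.1 ^ 2 = 1 - Real.cos (w φ).2.1 ^ 2 := Real.sin_sq _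
  simp only [liftedField]
  generalize √(a + b * Real.cos (w φ).1 ^ 2) = S at *
  rw [← hS]
  generalize 1 - b * Real.cos (w φ).1 ^ 2 = D
  by_cases hD : D = 0
  · simp [hD]
  field_simp
  rw [hb]
  linear_combination (-2 * b * Real.sin (w φ).1 * Real.cos (w φ).1) * hθ

end IsLiftedTrajectory

theorem sqrt_div_mul_sqrt_add {a b c : ℝ} (hab : 0 < a + b) :
    √((c + b) / (a + b)) * √(a + b) = √(c + b) := by
  rw [← Real.sqrt_mul' _ hab.le, div_mul_cancel₀ _ hab.ne']

namespace IsCentredTrajectory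

variable {a b c : ℝ} {w : ℝ → ℝ × ℝ × ℝ} {φ : ℝ}

theorem cos_initial (hw : IsCentredTrajectory a b c w) (ha : 0 < a) (hb0 : 0 < b)
    (hc : c ∈ Icc (-b) a) : Real.cos (w Real.pi).2.1 = √((c + b) / (a + b)) := by
  rw [hw.initial]
  refine Real.cos_arccos (by linarith [Real.sqrt_nonneg ((c + b) / (a + b))]) ?_
  rw [Real.sqrt_le_one, div_le_one (by positivity)]
  linarith [hc.2]

theorem polar (hw : IsCentredTrajectory a b c w) (ha : 0 < a) (hb0 : 0 < b)
    (hc : c ∈ Icc (-b) a) (hφ : φ ∈ Icc 0 (2 * Real.pi)) :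
    √b * Real.sin (w φ).1 = √(c + b) * Real.sin (w φ).2.2 ∧
      Real.cos (w φ).2.1 * √(a + b * Real.cos (w φ).1 ^ 2) =
        √(c + b) * Real.cos (w φ).2.2 := by
  set x := fun t => √b * Real.sin (w t).1
  set y := fun t => Real.cos (w t).2.1 * √(a + b * Real.cos (w t).1 ^ 2)
  have hconst : ∀ {f f' : ℝ → ℝ}, (∀ t ∈ Icc 0 (2 * Real.pi),
      HasDerivWithinAt f (f' t) (Icc 0 (2 * Real.pi)) t ∧ f' t = 0) → f φ = f Real.pi := by
    intro f f' h
    have := (convex_Icc 0 (2 * Real.pi)).norm_image_sub_le_of_norm_hasDerivWithin_le (C := 0)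
      (fun t ht => (h t ht).1) (fun t ht => by simp [(h t ht).2]) pi_mem_Icc hφ
    rw [zero_mul, norm_le_zero_iff, sub_eq_zero] at this
    exact this
  have hx := fun t ht => hw.lifted.hasDerivWithinAt_abscissa (φ := t) hb0 ha ht
  have hy := fun t ht => hw.lifted.hasDerivWithinAt_ordinate (φ := t) hb0 ha ht
  have hu : ∀ t ∈ Icc 0 (2 * Real.pi), HasDerivWithinAt (fun t => (w t).2.2)
      (liftedField a b (w t)).2.2 (Icc 0 (2 * Real.pi)) t := fun t ht => (hw.lifted t ht).snd.snd
  -- `h1` and `h2` are the coordinates of `(x, y)` turned back by the angle `u`; both are constant.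
  have h1 : x φ * Real.cos (w φ).2.2 - y φ * Real.sin (w φ).2.2 =
      x Real.pi * Real.cos (w Real.pi).2.2 - y Real.pi * Real.sin (w Real.pi).2.2 :=
    hconst fun t ht => ⟨((hx t ht).mul (hu t ht).cos).sub ((hy t ht).mul (hu t ht).sin), by ring⟩
  have h2 : x φ * Real.sin (w φ).2.2 + y φ * Real.cos (w φ).2.2 =
      x Real.pi * Real.sin (w Real.pi).2.2 + y Real.pi * Real.cos (w Real.pi).2.2 :=
    hconst fun t ht => ⟨((hx t ht).mul (hu t ht).sin).add ((hy t ht).mul (hu t ht).cos), by ring⟩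
  have hxpi : x Real.pi = 0 := by simp [x, hw.initial]
  have hypi : y Real.pi = √(c + b) := by
    simp only [y]
    rw [hw.cos_initial ha hb0 hc, ← sqrt_div_mul_sqrt_add (by positivity : 0 < a + b), hw.initial]
    simp
  have hupi : (w Real.pi).2.2 = 0 := by rw [hw.initial]
  simp only [hxpi, hypi, hupi, Real.sin_zero, Real.cos_zero, mul_zero, mul_one,
    zero_add, sub_zero] at h1 h2
  have hsc := Real.sin_sq_add_cos_sq (w φ).2.2
  constructor
  · change x φ = _
    linear_combination Real.cos (w φ).2.2 * h1 + Real.sin (w φ).2.2 * h2 - x φ * hsc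
  · change y φ = _
    linear_combination -Real.sin (w φ).2.2 * h1 + Real.cos (w φ).2.2 * h2 - y φ * hsc

theorem mul_sin_sq (hw : IsCentredTrajectory a b c w) (ha : 0 < a) (hb0 : 0 < b)
    (hc : c ∈ Icc (-b) a) (hφ : φ ∈ Icc 0 (2 * Real.pi)) :
    b * Real.sin (w φ).1 ^ 2 = (c + b) * Real.sin (w φ).2.2 ^ 2 := by
  have h := congrArg (· ^ 2) (hw.polar ha hb0 hc hφ).1
  simpa [mul_pow, Real.sq_sqrt hb0.le, Real.sq_sqrt (by linarith [hc.1] : 0 ≤ c + b)] using h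

theorem cos_sq_mul (hw : IsCentredTrajectory a b c w) (ha : 0 < a) (hb0 : 0 < b)
    (hc : c ∈ Icc (-b) a) (hφ : φ ∈ Icc 0 (2 * Real.pi)) :
    Real.cos (w φ).2.1 ^ 2 * (a + b * Real.cos (w φ).1 ^ 2) =
      (c + b) * Real.cos (w φ).2.2 ^ 2 := by
  have h := congrArg (· ^ 2) (hw.polar ha hb0 hc hφ).2
  simpa [mul_pow, Real.sq_sqrt (by positivity : 0 ≤ a + b * Real.cos (w φ).1 ^ 2),
    Real.sq_sqrt (by linarith [hc.1] : 0 ≤ c + b)] using h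

theorem isReducedTrajectory (hw : IsCentredTrajectory a b c w) (ha : 0 < a) (hb0 : 0 < b)
    (hc : c ∈ Icc (-b) a) :
    IsReducedTrajectory a b c (fun φ => (w φ).1) (fun φ => (w φ).2.1) where
  deriv_psi _ hφ := hw.lifted.hasDerivWithinAt_psi hφ
  deriv_theta _ hφ := hw.lifted.hasDerivWithinAt_theta hφ
  first_integral φ hφ := by
    have h1 := hw.mul_sin_sq ha hb0 hc hφ
    have h2 := hw.cos_sq_mul ha hb0 hc hφ
    rw [Real.sin_sq] at h1 ⊢
    rw [Real.sin_sq] at h1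
    linear_combination h1 + h2

/-- Reversing time reflects a centred trajectory. -/
theorem psi_reflect (hw : IsCentredTrajectory a b c w) (ha : 0 < a) (hb0 : 0 < b) (hb1 : b < 1)
    (hφ : φ ∈ Icc 0 (2 * Real.pi)) : (w (2 * Real.pi - φ)).1 = -(w φ).1 := by
  have hmaps : MapsTo (fun t => 2 * Real.pi - t) (Icc 0 (2 * Real.pi)) (Icc 0 (2 * Real.pi)) :=
    fun t ht => ⟨by linarith [ht.2], by linarith [ht.1]⟩
  have hrev : ∀ t : ℝ, HasDerivWithinAt (fun t => 2 * Real.pi - t) (-1) (Icc 0 (2 * Real.pi)) t :=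
    fun t => (hasDerivWithinAt_id t _).const_sub _
  -- The map `(ψ, θ, u) ↦ (-ψ, θ, -u)` changes the sign of the field and fixes the state at time
  -- `π`.
  have hlift : IsLiftedTrajectory a b (fun t => (-(w (2 * Real.pi - t)).1,
      (w (2 * Real.pi - t)).2.1, -(w (2 * Real.pi - t)).2.2)) := by
    intro t ht
    have h := (hw.lifted _ (hmaps ht)).scomp t (hrev t) hmaps
    have h1 : HasDerivWithinAt (fun t => (w (2 * Real.pi - t)).1) _ _ t := h.fst
    have h2 : HasDerivWithinAt (fun t => (w (2 * Real.pi - t)).2.1) _ _ t := h.snd.fst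
    have h3 : HasDerivWithinAt (fun t => (w (2 * Real.pi - t)).2.2) _ _ t := h.snd.snd
    refine (h1.fun_neg.prodMk (h2.prodMk h3.fun_neg)).congr_deriv ?_
    simp [liftedField, neg_div]
  have heq := hlift.eqOn ha hb0 hb1 hw.lifted pi_mem_Icc (by
    rw [show 2 * Real.pi - Real.pi = Real.pi by ring, hw.initial]; simp) hφ
  have := congrArg Prod.fst heq
  simp only at this
  linarith

end IsCentredTrajectory

/-! ### The curve as a graph over the first integral -/

/-- Reflections and translations of `θ` by multiples of `2π` preserve the reduced system, and
every reduced trajectory extends to the lifted system. -/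
theorem IsReducedTrajectory.exists_isLiftedTrajectory {a b c : ℝ} {ψ θ : ℝ → ℝ}
    (hb0 : 0 < b) (hb1 : b < 1) (h : IsReducedTrajectory a b c ψ θ) (σ τ : ℝ)
    (hcos : ∀ x, Real.cos (τ + σ * x) = Real.cos x)
    (hsin : ∀ x, Real.sin (τ + σ * x) = σ * Real.sin x) :
    ∃ u : ℝ → ℝ, u Real.pi = 0 ∧ IsLiftedTrajectory a b (fun φ => (ψ φ, τ + σ * θ φ, u φ)) := by
  have hpi : (0 : ℝ) ≤ 2 * Real.pi := by linarith [Real.pi_pos]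
  have hψ : ContinuousOn ψ (Icc 0 (2 * Real.pi)) := HasDerivWithinAt.continuousOn h.deriv_psi
  -- `ψ` is controlled only on `[0, 2π]`; a continuous extension makes the integral defining `u`
  -- differentiable everywhere.
  obtain ⟨χ, hχ, hχψ⟩ : ∃ χ : ℝ → ℝ, Continuous χ ∧ EqOn χ ψ (Icc 0 (2 * Real.pi)) :=
    ⟨IccExtend hpi (domRestrict _ ψ), (continuousOn_iff_continuous_domRestrict.1 hψ).Icc_extend',
      fun φ hφ => IccExtend_of_mem hpi _ hφ⟩
  have hg : Continuous fun s => √b * Real.cos (χ s) * √(a + b * Real.cos (χ s) ^ 2) /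
      (1 - b * Real.cos (χ s) ^ 2) := by
    refine Continuous.div (by fun_prop) (by fun_prop) fun s => ?_
    exact (one_sub_mul_sq_pos hb0 hb1 (Real.cos_sq_le_one _)).ne'
  refine ⟨fun φ => ∫ s in Real.pi..φ, √b * Real.cos (χ s) * √(a + b * Real.cos (χ s) ^ 2) /
      (1 - b * Real.cos (χ s) ^ 2), intervalIntegral.integral_same, fun φ hφ => ?_⟩
  have hu := (hg.integral_hasStrictDerivAt Real.pi φ).hasDerivAt.hasDerivWithinAt
    (s := Icc 0 (2 * Real.pi))
  refine ((h.deriv_psi φ hφ).prodMk ((((h.deriv_theta φ hφ).const_mul σ).const_add τ).prodMk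
    hu)).congr_deriv ?_
  simp only [liftedField, hcos, hsin, hχψ hφ]
  congr 2
  ring

theorem IsReducedTrajectory.mem_Icc {a b c : ℝ} {ψ θ : ℝ → ℝ} (ha : 0 < a) (hb0 : 0 < b)
    (h : IsReducedTrajectory a b c ψ θ) (h0 : ψ Real.pi = 0) : c ∈ Icc (-b) a := by
  have hc := h.first_integral _ pi_mem_Icc
  rw [h0, Real.cos_zero, one_pow, mul_one] at hc
  constructor
  · nlinarith [Real.sin_sq_le_one (θ Real.pi)]
  · nlinarith [sq_nonneg (Real.sin (θ Real.pi))]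

/-- The first integral and the sign condition fix `cos θ(π)`, hence `θ(π)` up to sign and multiples
of `2π`. The symmetries in `θ` remove that ambiguity without touching `ψ`, and uniqueness applies.
-/
theorem IsReducedTrajectory.eqOn_psi {a b c : ℝ} {ψ θ : ℝ → ℝ} {w : ℝ → ℝ × ℝ × ℝ} (ha : 0 < a)
    (hb0 : 0 < b) (hb1 : b < 1) (h : IsReducedTrajectory a b c ψ θ) (h0 : ψ Real.pi = 0)
    (hθ : 0 ≤ Real.cos (θ Real.pi)) (hw : IsCentredTrajectory a b c w) :
    EqOn ψ (fun φ => (w φ).1) (Icc 0 (2 * Real.pi)) := by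
  have hc := h.first_integral _ pi_mem_Icc
  rw [h0, Real.cos_zero, one_pow, mul_one, Real.sin_sq] at hc
  have hcos : Real.cos (θ Real.pi) = Real.cos (Real.arccos √((c + b) / (a + b))) := by
    have := hw.cos_initial ha hb0 (h.mem_Icc ha hb0 h0)
    rw [hw.initial] at this
    rw [this, eq_comm, Real.sqrt_eq_iff_eq_sq _ hθ, div_eq_iff (by positivity)]
    · linear_combination -hc
    · have := (h.mem_Icc ha hb0 h0).1
      exact div_nonneg (by linarith) (by positivity)
  have key : ∃ σ τ : ℝ, (∀ x, Real.cos (τ + σ * x) = Real.cos x) ∧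
      (∀ x, Real.sin (τ + σ * x) = σ * Real.sin x) ∧
      τ + σ * θ Real.pi = Real.arccos √((c + b) / (a + b)) := by
    obtain ⟨k, hk | hk⟩ := Real.cos_eq_cos_iff.1 hcos
    · refine ⟨1, 2 * k * Real.pi, fun x => ?_, fun x => ?_, by rw [hk, one_mul]⟩
      · rw [one_mul, add_comm, show 2 * k * Real.pi = k * (2 * Real.pi) by ring,
          Real.cos_add_int_mul_two_pi]
      · rw [one_mul, one_mul, add_comm, show 2 * k * Real.pi = k * (2 * Real.pi) by ring,
          Real.sin_add_int_mul_two_pi]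
    · refine ⟨-1, 2 * k * Real.pi, fun x => ?_, fun x => ?_, by rw [hk]; ring⟩
      · rw [neg_one_mul, add_comm, show 2 * k * Real.pi = k * (2 * Real.pi) by ring,
          Real.cos_add_int_mul_two_pi, Real.cos_neg]
      · rw [neg_one_mul, add_comm, show 2 * k * Real.pi = k * (2 * Real.pi) by ring,
          Real.sin_add_int_mul_two_pi, Real.sin_neg, neg_one_mul]
  obtain ⟨σ, τ, h1, h2, h3⟩ := key
  obtain ⟨u, hu0, hu⟩ := h.exists_isLiftedTrajectory hb0 hb1 σ τ h1 h2
  intro φ hφ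
  have := hu.eqOn ha hb0 hb1 hw.lifted pi_mem_Icc (by rw [h0, h3, hu0, hw.initial]) hφ
  exact congrArg Prod.fst this

/-- A family of centred trajectories, indexed by the first integral, that depends continuously
on it. -/
theorem exists_isCentredTrajectory {a b : ℝ} (ha : 0 < a) (hb0 : 0 < b) (hb1 : b < 1) :
    ∃ W : ℝ → ℝ → ℝ × ℝ × ℝ, (∀ c, IsCentredTrajectory a b c (W c)) ∧
      Continuous fun c => W c (2 * Real.pi) := by
  -- Radius `π` contains all the initial states, since `arccos` takes values in `[0, π]`.
  obtain ⟨α, hα, K, hK⟩ := exists_liftedFlow ha hb0 hb1 Real.pi.toNNReal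
  have hmem : ∀ c, ((0 : ℝ), Real.arccos √((c + b) / (a + b)), (0 : ℝ)) ∈
      closedBall (0 : ℝ × ℝ × ℝ) (Real.pi.toNNReal : ℝ) := by
    intro c
    rw [Real.coe_toNNReal _ Real.pi_pos.le, mem_closedBall_zero_iff]
    simp [Prod.norm_def, abs_of_nonneg (Real.arccos_nonneg _), Real.arccos_le_pi, Real.pi_pos.le]
  refine ⟨fun c => α (0, Real.arccos √((c + b) / (a + b)), 0),
    fun c => ⟨(hα _ (hmem c)).2, (hα _ (hmem c)).1⟩, ?_⟩
  -- Outside `[-b, a]` the square root and `arccos` are clamped to constants, so continuity holds on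
  -- all of `ℝ`.
  have hcont : Continuous fun c : ℝ =>
      ((0 : ℝ), Real.arccos √((c + b) / (a + b)), (0 : ℝ)) := by
    have := Real.continuous_arccos
    fun_prop
  exact (hK _ ⟨by linarith [Real.pi_pos], le_rfl⟩).continuousOn.comp_continuous hcont hmem

theorem tennisRacketCurve_eq_graphOn {a b : ℝ} (ha : 0 < a) (hb0 : 0 < b) (hb1 : b < 1)
    {W : ℝ → ℝ → ℝ × ℝ × ℝ} (hW : ∀ c, IsCentredTrajectory a b c (W c)) :
    tennisRacketCurve a b =
      (Icc (-b) a).graphOn fun c => Real.pi / 2 - (W c (2 * Real.pi)).1 := by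
  have hend : 2 * Real.pi ∈ Icc 0 (2 * Real.pi) := ⟨by linarith [Real.pi_pos], le_rfl⟩
  ext ⟨c, ε⟩
  rw [mem_graphOn]
  constructor
  · rintro ⟨ψ, θ, h, -, h2, h0, hθ⟩
    refine ⟨h.mem_Icc ha hb0 h0, ?_⟩
    have := h.eqOn_psi ha hb0 hb1 h0 hθ (hW c) hend
    simp only at this h2 ⊢
    linarith
  · rintro ⟨hc, h⟩
    simp only at h hc
    have hr := (hW c).psi_reflect ha hb0 hb1 hend
    rw [sub_self] at hr
    refine ⟨fun φ => (W c φ).1, fun φ => (W c φ).2.1, (hW c).isReducedTrajectory ha hb0 hc,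
      ?_, ?_, ?_, ?_⟩
    · simp only [hr]; linarith
    · simp only; linarith
    · simp [(hW c).initial]
    · simp only [(hW c).cos_initial ha hb0 hc]
      positivity

/-! ### Angular speed and tools of real analysis -/

/-- The speed of the polar angle as a function of `cos ψ`. -/
noncomputable def angularSpeed (a b x : ℝ) : ℝ := √b * x * √(a + b * x ^ 2) / (1 - b * x ^ 2)

theorem angularSpeed_pos {a b x : ℝ} (ha : 0 < a) (hb0 : 0 < b) (hb1 : b < 1) (hx0 : 0 < x)
    (hx1 : x ≤ 1) : 0 < angularSpeed a b x :=
  div_pos (by positivity) (one_sub_mul_sq_pos hb0 hb1 (by nlinarith))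

theorem strictMonoOn_angularSpeed {a b : ℝ} (ha : 0 < a) (hb0 : 0 < b) (hb1 : b < 1) :
    StrictMonoOn (angularSpeed a b) (Ioc 0 1) := by
  intro x hx y hy hxy
  have hx0 := hx.1
  have hy0 := hy.1
  have hsq : x ^ 2 < y ^ 2 := by nlinarith
  refine div_lt_div₀ ?_ (by nlinarith) (by positivity)
    (one_sub_mul_sq_pos hb0 hb1 (by nlinarith [hy.2]))
  refine mul_lt_mul (by gcongr) (Real.sqrt_le_sqrt (by gcongr)) (by positivity) (by positivity)

/-- The angular speed at `ψ = 0` is the reciprocal of the geometric constant. -/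
theorem angularSpeed_one_le_one_iff {a b : ℝ} (ha : 0 < a) (hb0 : 0 < b) (hb1 : b < 1) :
    angularSpeed a b 1 ≤ 1 ↔ 1 ≤ geometricConstant a b := by
  have h : 0 < √b * √(a + b) := by positivity
  rw [angularSpeed, geometricConstant, Real.sqrt_mul hb0.le, one_le_div h, one_pow, mul_one,
    mul_one, div_le_one (by linarith)]

theorem mem_Ioo_of_cos_ne_zero {f : ℝ → ℝ} {p q x y : ℝ} (hf : ContinuousOn f (Icc p q))
    (hcos : ∀ t ∈ Icc p q, Real.cos (f t) ≠ 0) (hx : x ∈ Icc p q) (hfx : f x = 0)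
    (hy : y ∈ Icc p q) : f y ∈ Ioo (-(Real.pi / 2)) (Real.pi / 2) := by
  have hpi := Real.pi_pos
  constructor
  · by_contra! h
    obtain ⟨z, hz, hfz⟩ := isPreconnected_Icc.intermediate_value hy hx hf
      (show -(Real.pi / 2) ∈ Icc (f y) (f x) from ⟨h, by linarith⟩)
    exact hcos z hz (by rw [hfz, Real.cos_neg, Real.cos_pi_div_two])
  · by_contra! h
    obtain ⟨z, hz, hfz⟩ := isPreconnected_Icc.intermediate_value hx hy hf
      (show Real.pi / 2 ∈ Icc (f x) (f y) from ⟨by linarith, h⟩)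
    exact hcos z hz (by rw [hfz, Real.cos_pi_div_two])

/-- The function can cross zero only upwards, so it stays nonnegative. A later zero would then have
nonpositive slopes from the left, against the positive derivative there. -/
theorem pos_of_deriv_pos_of_eq_zero {f f' : ℝ → ℝ} {p q : ℝ}
    (hf : ∀ t ∈ Icc p q, HasDerivWithinAt f (f' t) (Icc p q) t) (hp : f p = 0)
    (h : ∀ t ∈ Icc p q, f t = 0 → 0 < f' t) {t : ℝ} (ht : t ∈ Ioc p q) : 0 < f t := by
  have hnonneg : ∀ ⦃s⦄, s ∈ Icc p q → (0 : ℝ) ≤ f s :=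
    image_le_of_deriv_right_lt_deriv_boundary' (f := fun _ => 0) (f' := fun _ => 0)
      continuousOn_const (fun s _ => hasDerivWithinAt_const s _ 0) hp.ge
      (HasDerivWithinAt.continuousOn hf)
      (fun s hs => (hf s (Ico_subset_Icc_self hs)).mono_of_mem_nhdsWithin
        (Filter.mem_of_superset (Icc_mem_nhdsGE hs.2) (Icc_subset_Icc_left hs.1)))
      fun s hs h0 => h s (Ico_subset_Icc_self hs) h0.symm
  have htI := Ioc_subset_Icc_self ht
  refine (hnonneg htI).lt_of_ne fun h0 => ?_
  have hd : HasDerivWithinAt f (f' t) (Iio t) t := (hf t htI).mono_of_mem_nhdsWithin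
    (Filter.mem_of_superset (Icc_mem_nhdsLT ht.1) (Icc_subset_Icc_right ht.2))
  have hlim := (hasDerivWithinAt_iff_tendsto_slope' self_notMem_Iio).1 hd
  refine absurd (le_of_tendsto hlim ?_) (h t htI h0.symm).not_ge
  filter_upwards [Ioo_mem_nhdsLT ht.1] with s hs
  rw [slope_def_field, ← h0, sub_zero]
  exact div_nonpos_of_nonneg_of_nonpos (hnonneg ⟨hs.1.le, hs.2.le.trans ht.2⟩)
    (by linarith [hs.2])

/-- The value halfway between `f m` and `f p = f r` is taken on both sides of `m`, and on the left
strictly inside `(p, m)`. -/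
theorem not_injOn_Ioo_of_eq {f : ℝ → ℝ} (hf : Continuous f) {p r s : ℝ} (hpr : p < r) (hrs : r < s)
    (h : f p = f r) : ¬ InjOn f (Ioo p s) := by
  intro hinj
  obtain ⟨m, hpm, hmr⟩ := exists_between hpr
  have hm : m ∈ Ioo p s := ⟨hpm, hmr.trans hrs⟩
  have hne : f m ≠ f r := fun h' => hmr.ne (hinj hm ⟨hpr, hrs⟩ h')
  have hv : (f m + f r) / 2 ∈ uIcc (f m) (f r) := by
    rw [mem_uIcc]
    rcases le_total (f m) (f r) with h' | h'
    · left; constructor <;> linarith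
    · right; constructor <;> linarith
  have hv' : (f m + f r) / 2 ∈ uIcc (f p) (f m) := by rwa [h, uIcc_comm]
  obtain ⟨x, hx, hfx⟩ := intermediate_value_uIcc hf.continuousOn hv'
  obtain ⟨y, hy, hfy⟩ := intermediate_value_uIcc hf.continuousOn hv
  rw [uIcc_of_le hpm.le] at hx
  rw [uIcc_of_le hmr.le] at hy
  have hxp : x ≠ p := by
    rintro rfl
    exact hne (by linarith)
  have hxm : x ≠ m := by
    rintro rfl
    exact hne (by linarith)
  have hx' : p < x := hx.1.lt_of_ne' hxp
  have hx'' : x < m := hx.2.lt_of_ne hxm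
  have := hinj ⟨hx', hx''.trans hm.2⟩ ⟨hpm.trans_le hy.1, hy.2.trans_lt hrs⟩ (hfx.trans hfy.symm)
  linarith [hy.1]

/-! ### Librations, rotations and bounds on the polar angle -/

namespace IsCentredTrajectory

variable {a b c : ℝ} {w : ℝ → ℝ × ℝ × ℝ} {φ : ℝ}

theorem cos_sq_psi (hw : IsCentredTrajectory a b c w) (ha : 0 < a) (hb0 : 0 < b)
    (hc : c ∈ Icc (-b) a) (hφ : φ ∈ Icc 0 (2 * Real.pi)) :
    Real.cos (w φ).1 ^ 2 = 1 - (c + b) / b * Real.sin (w φ).2.2 ^ 2 := by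
  have h := hw.mul_sin_sq ha hb0 hc hφ
  rw [Real.cos_sq']
  field_simp
  linarith

/-- At `cos ψ = 0` the relation `b sin² ψ = (c + b) sin² u` would give `b ≤ c + b`, impossible for
`c < 0`. -/
theorem psi_mem_Ioo (hw : IsCentredTrajectory a b c w) (ha : 0 < a) (hb0 : 0 < b)
    (hc : c ∈ Ico (-b) 0) (hφ : φ ∈ Icc 0 (2 * Real.pi)) :
    (w φ).1 ∈ Ioo (-(Real.pi / 2)) (Real.pi / 2) := by
  refine mem_Ioo_of_cos_ne_zero (f := fun t => (w t).1)
    (continuous_fst.comp_continuousOn hw.lifted.continuousOn) (fun t ht h => ?_) pi_mem_Icc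
    (by simp [hw.initial]) hφ
  have h1 := hw.mul_sin_sq ha hb0 ⟨hc.1, hc.2.le.trans ha.le⟩ ht
  rw [Real.sin_sq (w t).1, h] at h1
  nlinarith [Real.sin_sq_le_one (w t).2.2, hc.1, hc.2]

/-- At `cos u = 0` one has `b sin² ψ = c + b ≥ b`, which forces `cos ψ = cos θ = 0`. That state is a
rest point of the lifted field, and a trajectory with `ψ(π) = 0` cannot reach it. -/
theorem angle_mem_Ioo (hw : IsCentredTrajectory a b c w) (ha : 0 < a) (hb0 : 0 < b) (hb1 : b < 1)
    (hc : c ∈ Icc 0 a) (hφ : φ ∈ Icc 0 (2 * Real.pi)) :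
    (w φ).2.2 ∈ Ioo (-(Real.pi / 2)) (Real.pi / 2) := by
  have hc' : c ∈ Icc (-b) a := ⟨by linarith [hc.1], hc.2⟩
  refine mem_Ioo_of_cos_ne_zero (f := fun t => (w t).2.2)
    (continuous_snd.comp_continuousOn (continuous_snd.comp_continuousOn hw.lifted.continuousOn))
    (fun t ht h => ?_) pi_mem_Icc (by simp [hw.initial]) hφ
  have h1 := hw.mul_sin_sq ha hb0 hc' ht
  have h2 := hw.cos_sq_mul ha hb0 hc' ht
  rw [Real.sin_sq, Real.sin_sq, h] at h1
  have hψ : Real.cos (w t).1 = 0 := by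
    rw [← sq_eq_zero_iff]
    nlinarith [sq_nonneg (Real.cos (w t).1), hc.1]
  have hθ : Real.cos (w t).2.1 = 0 := by
    rw [h, hψ] at h2
    rw [← sq_eq_zero_iff]
    nlinarith
  have hconst : IsLiftedTrajectory a b fun _ => w t := by
    intro s _
    refine (hasDerivWithinAt_const s _ (w t)).congr_deriv ?_
    simp [liftedField, hψ, hθ, Prod.ext_iff]
  have := hw.lifted.eqOn ha hb0 hb1 hconst ht rfl pi_mem_Icc
  simp only [hw.initial] at this
  simp [← this] at hψ

theorem cos_psi_mem_Ioc (hw : IsCentredTrajectory a b c w) (ha : 0 < a) (hb0 : 0 < b)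
    (hc : c ∈ Ico (-b) 0) (hφ : φ ∈ Icc 0 (2 * Real.pi)) : Real.cos (w φ).1 ∈ Ioc 0 1 :=
  ⟨Real.cos_pos_of_mem_Ioo (hw.psi_mem_Ioo ha hb0 hc hφ), Real.cos_le_one _⟩

theorem cos_psi_eq_sqrt (hw : IsCentredTrajectory a b c w) (ha : 0 < a) (hb0 : 0 < b)
    (hc : c ∈ Ico (-b) 0) (hφ : φ ∈ Icc 0 (2 * Real.pi)) :
    Real.cos (w φ).1 = √(1 - (c + b) / b * Real.sin (w φ).2.2 ^ 2) := by
  rw [← hw.cos_sq_psi ha hb0 ⟨hc.1, hc.2.le.trans ha.le⟩ hφ,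
    Real.sqrt_sq (hw.cos_psi_mem_Ioc ha hb0 hc hφ).1.le]

theorem hasDerivWithinAt_angle_second_half (hw : IsCentredTrajectory a b c w)
    (hφ : φ ∈ Icc Real.pi (2 * Real.pi)) :
    HasDerivWithinAt (fun t => (w t).2.2) (angularSpeed a b (Real.cos (w φ).1))
      (Icc Real.pi (2 * Real.pi)) φ :=
  (hw.lifted.hasDerivWithinAt_angle (Icc_subset_Icc_left Real.pi_pos.le hφ)).mono
    (Icc_subset_Icc_left Real.pi_pos.le)

theorem angle_pos (hw : IsCentredTrajectory a b c w) (ha : 0 < a) (hb0 : 0 < b) (hb1 : b < 1)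
    (hc : c ∈ Ico (-b) 0) (hφ : φ ∈ Ioc Real.pi (2 * Real.pi)) : 0 < (w φ).2.2 := by
  have hmono := strictMonoOn_of_hasDerivWithinAt_pos (convex_Icc Real.pi (2 * Real.pi))
    (HasDerivWithinAt.continuousOn fun t ht => hw.hasDerivWithinAt_angle_second_half ht)
    (fun t ht => (hw.hasDerivWithinAt_angle_second_half (interior_subset ht)).mono interior_subset)
    fun t ht => by
      have := hw.cos_psi_mem_Ioc ha hb0 hc
        (Icc_subset_Icc_left Real.pi_pos.le (interior_subset ht))
      exact angularSpeed_pos ha hb0 hb1 this.1 this.2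
  have := hmono (left_mem_Icc.2 (hφ.1.le.trans hφ.2)) (Ioc_subset_Icc_self hφ) hφ.1
  simpa [hw.initial] using this

theorem angle_le (hw : IsCentredTrajectory a b c w) (ha : 0 < a) (hb0 : 0 < b) (hb1 : b < 1)
    (hω : angularSpeed a b 1 ≤ 1) (hc : c ∈ Ico (-b) 0) (hφ : φ ∈ Icc Real.pi (2 * Real.pi)) :
    (w φ).2.2 ≤ φ - Real.pi := by
  have hd : ∀ t ∈ Icc Real.pi (2 * Real.pi), HasDerivWithinAt (fun t => t - (w t).2.2)
      (1 - angularSpeed a b (Real.cos (w t).1)) (Icc Real.pi (2 * Real.pi)) t :=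
    fun t ht => (hasDerivWithinAt_id t _).fun_sub (hw.hasDerivWithinAt_angle_second_half ht)
  have hmono := monotoneOn_of_hasDerivWithinAt_nonneg (convex_Icc Real.pi (2 * Real.pi))
    (HasDerivWithinAt.continuousOn hd)
    (fun t ht => (hd t (interior_subset ht)).mono interior_subset)
    fun t ht => by
      have := hw.cos_psi_mem_Ioc ha hb0 hc
        (Icc_subset_Icc_left Real.pi_pos.le (interior_subset ht))
      have := (strictMonoOn_angularSpeed ha hb0 hb1).monotoneOn this ⟨one_pos, le_rfl⟩ this.2
      linarith
  have := hmono (left_mem_Icc.2 (hφ.1.trans hφ.2)) hφ hφ.1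
  simp only [hw.initial] at this
  linarith

/-- The weak bound keeps `u` inside `(0, π)` before time `2π`. There `sin u > 0`, so `cos ψ < 1` and
the angular speed is strictly below its maximum. -/
theorem angle_lt (hw : IsCentredTrajectory a b c w) (ha : 0 < a) (hb0 : 0 < b) (hb1 : b < 1)
    (hω : angularSpeed a b 1 ≤ 1) (hc : c ∈ Ioo (-b) 0) (hφ : φ ∈ Ioc Real.pi (2 * Real.pi)) :
    (w φ).2.2 < φ - Real.pi := by
  have hc' := Ioo_subset_Ico_self hc
  have hd : ∀ t ∈ Icc Real.pi (2 * Real.pi), HasDerivWithinAt (fun t => t - (w t).2.2)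
      (1 - angularSpeed a b (Real.cos (w t).1)) (Icc Real.pi (2 * Real.pi)) t :=
    fun t ht => (hasDerivWithinAt_id t _).fun_sub (hw.hasDerivWithinAt_angle_second_half ht)
  have hmono := strictMonoOn_of_hasDerivWithinAt_pos (convex_Icc Real.pi (2 * Real.pi))
    (HasDerivWithinAt.continuousOn hd)
    (fun t ht => (hd t (interior_subset ht)).mono interior_subset)
    fun t ht => by
      have htI := Icc_subset_Icc_left Real.pi_pos.le (interior_subset ht)
      have hcos := hw.cos_psi_mem_Ioc ha hb0 hc' htI
      have hle := hw.angle_le ha hb0 hb1 hω hc' (interior_subset ht)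
      rw [interior_Icc] at ht
      have hsin : 0 < Real.sin (w t).2.2 := Real.sin_pos_of_pos_of_lt_pi
        (hw.angle_pos ha hb0 hb1 hc' (Ioo_subset_Ioc_self ht)) (by linarith [ht.2])
      have hsq := hw.cos_sq_psi ha hb0 ⟨hc'.1, hc.2.le.trans ha.le⟩ htI
      have hk : 0 < (c + b) / b := div_pos (by linarith [hc.1]) hb0
      have hpos : 0 < (c + b) / b * Real.sin (w t).2.2 ^ 2 := by positivity
      have hlt : Real.cos (w t).1 < 1 := by nlinarith [hcos.1]
      have := strictMonoOn_angularSpeed ha hb0 hb1 hcos ⟨one_pos, le_rfl⟩ hlt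
      linarith
  have := hmono (left_mem_Icc.2 (hφ.1.le.trans hφ.2)) (Ioc_subset_Icc_self hφ) hφ.1
  simp only [hw.initial] at this
  linarith

/-- The polar angle turns more slowly on librations of larger amplitude. -/
theorem angle_le_angle {c₁ c₂ : ℝ} {w₁ w₂ : ℝ → ℝ × ℝ × ℝ} (h₁ : IsCentredTrajectory a b c₁ w₁)
    (h₂ : IsCentredTrajectory a b c₂ w₂) (ha : 0 < a) (hb0 : 0 < b) (hb1 : b < 1)
    (hc₁ : -b ≤ c₁) (hc : c₁ ≤ c₂) (hc₂ : c₂ < 0) (hφ : φ ∈ Icc Real.pi (2 * Real.pi)) :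
    (w₂ φ).2.2 ≤ (w₁ φ).2.2 := by
  set κ := (c₂ + b) / b with hκ
  have hκ0 : 0 ≤ κ := div_nonneg (by linarith) hb0.le
  have hκ1 : κ < 1 := by rw [hκ, div_lt_one hb0]; linarith
  have hrad : ∀ v, 0 < 1 - κ * Real.sin v ^ 2 := fun v => by
    nlinarith [Real.sin_sq_le_one v, sq_nonneg (Real.sin v)]
  have hrad' : ∀ v, √(1 - κ * Real.sin v ^ 2) ∈ Ioc 0 1 := fun v => by
    refine ⟨Real.sqrt_pos.2 (hrad v), Real.sqrt_le_one.2 ?_⟩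
    have := mul_nonneg hκ0 (sq_nonneg (Real.sin v))
    linarith
  set G : ℝ → ℝ := fun v => angularSpeed a b √(1 - κ * Real.sin v ^ 2) with hG
  have hGpos : ∀ v, 0 < G v := fun v => angularSpeed_pos ha hb0 hb1 (hrad' v).1 (hrad' v).2
  have hGcont : Continuous G := by
    refine Continuous.div (by fun_prop) (by fun_prop) fun v => ?_
    exact (one_sub_mul_sq_pos hb0 hb1 (by nlinarith [(hrad' v).1, (hrad' v).2])).ne'
  have hFcont : Continuous fun v => (G v)⁻¹ := hGcont.inv₀ fun v => (hGpos v).ne'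
  -- `H x` is the time in which the polar angle of the `c₂` libration goes from 0 to `x`. Thus
  -- `H(u₂)` grows at rate 1, and `H(u₁)` at rate at least 1.
  set H : ℝ → ℝ := fun x => ∫ v in (0 : ℝ)..x, (G v)⁻¹ with hH
  have hHd : ∀ x, HasDerivAt H (G x)⁻¹ x := fun x =>
    (hFcont.integral_hasStrictDerivAt 0 x).hasDerivAt
  have hHmono : StrictMono H := strictMono_of_hasDerivAt_pos hHd fun x => inv_pos.2 (hGpos x)
  have hd : ∀ t ∈ Icc Real.pi (2 * Real.pi), HasDerivWithinAt
      (fun t => H (w₁ t).2.2 - H (w₂ t).2.2)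
      ((G (w₁ t).2.2)⁻¹ * angularSpeed a b (Real.cos (w₁ t).1) -
        (G (w₂ t).2.2)⁻¹ * angularSpeed a b (Real.cos (w₂ t).1))
      (Icc Real.pi (2 * Real.pi)) t := fun t ht =>
    ((hHd _).comp_hasDerivWithinAt t (h₁.hasDerivWithinAt_angle_second_half ht)).fun_sub
      ((hHd _).comp_hasDerivWithinAt t (h₂.hasDerivWithinAt_angle_second_half ht))
  have hmono := monotoneOn_of_hasDerivWithinAt_nonneg (convex_Icc Real.pi (2 * Real.pi))
    (HasDerivWithinAt.continuousOn hd)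
    (fun t ht => (hd t (interior_subset ht)).mono interior_subset)
    fun t ht => by
      have htI := Icc_subset_Icc_left Real.pi_pos.le (interior_subset ht)
      have e2 : angularSpeed a b (Real.cos (w₂ t).1) = G (w₂ t).2.2 := by
        rw [h₂.cos_psi_eq_sqrt ha hb0 ⟨hc₁.trans hc, hc₂⟩ htI]
      have e1 : G (w₁ t).2.2 ≤ angularSpeed a b (Real.cos (w₁ t).1) := by
        refine (strictMonoOn_angularSpeed ha hb0 hb1).monotoneOn (hrad' _)
          (h₁.cos_psi_mem_Ioc ha hb0 ⟨hc₁, hc.trans_lt hc₂⟩ htI) ?_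
        rw [h₁.cos_psi_eq_sqrt ha hb0 ⟨hc₁, hc.trans_lt hc₂⟩ htI]
        refine Real.sqrt_le_sqrt ?_
        have : (c₁ + b) / b ≤ κ := by rw [hκ]; gcongr
        nlinarith [sq_nonneg (Real.sin (w₁ t).2.2)]
      rw [e2, inv_mul_cancel₀ (hGpos _).ne', sub_nonneg, inv_mul_eq_div, one_le_div (hGpos _)]
      exact e1
  have := hmono (left_mem_Icc.2 (hφ.1.trans hφ.2)) hφ hφ.1
  simp only [h₁.initial, h₂.initial, sub_self, sub_nonneg] at this
  exact hHmono.le_iff_le.1 this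

end IsCentredTrajectory

/-! ### Monotonicity in the first integral -/

namespace IsCentredTrajectory

variable {a b c : ℝ} {w : ℝ → ℝ × ℝ × ℝ} {φ : ℝ}

/-- Where two centred trajectories meet, the polar angle of the faster one is still acute. -/
theorem cos_angle_nonneg_of_psi_eq {c₁ c₂ : ℝ} {w₁ w₂ : ℝ → ℝ × ℝ × ℝ}
    (h₁ : IsCentredTrajectory a b c₁ w₁) (h₂ : IsCentredTrajectory a b c₂ w₂) (ha : 0 < a)
    (hb0 : 0 < b) (hb1 : b < 1) (hω : angularSpeed a b 1 ≤ 1) (hc₁ : -b ≤ c₁) (hc : c₁ < c₂)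
    (hc₂ : c₂ ≤ a) (hφ : φ ∈ Icc Real.pi (2 * Real.pi)) (heq : (w₁ φ).1 = (w₂ φ).1) :
    0 ≤ Real.cos (w₂ φ).2.2 := by
  have hφ' := Icc_subset_Icc_left Real.pi_pos.le hφ
  rcases le_or_gt 0 c₂ with h0 | h0
  · exact (Real.cos_pos_of_mem_Ioo (h₂.angle_mem_Ioo ha hb0 hb1 ⟨h0, hc₂⟩ hφ')).le
  rcases hφ.1.eq_or_lt with rfl | hlt
  · simp [h₂.initial]
  -- If `u₂` is obtuse, then `π/2 < u₂ ≤ u₁ ≤ φ - π ≤ π`, where sine decreases, so `sin u₁ ≤ sin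
  -- u₂`. Equal `ψ` requires `√(c₁ + b) sin u₁ = √(c₂ + b) sin u₂`, but the right side is larger.
  by_contra! hcos
  have hI₂ : c₂ ∈ Ioo (-b) 0 := ⟨hc₁.trans_lt hc, h0⟩
  have hpos := h₂.angle_pos ha hb0 hb1 (Ioo_subset_Ico_self hI₂) ⟨hlt, hφ.2⟩
  have hlt₂ := h₂.angle_lt ha hb0 hb1 hω hI₂ ⟨hlt, hφ.2⟩
  have hle₁ := h₁.angle_le ha hb0 hb1 hω ⟨hc₁, hc.trans h0⟩ hφ
  have hle := h₁.angle_le_angle h₂ ha hb0 hb1 hc₁ hc.le h0 hφ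
  have hhalf : Real.pi / 2 < (w₂ φ).2.2 := by
    by_contra! h
    exact hcos.not_ge (Real.cos_nonneg_of_mem_Icc ⟨by linarith [Real.pi_pos], h⟩)
  have hsin₂ : 0 < Real.sin (w₂ φ).2.2 := Real.sin_pos_of_pos_of_lt_pi hpos (by linarith [hφ.2])
  have hsin : Real.sin (w₁ φ).2.2 ≤ Real.sin (w₂ φ).2.2 := by
    rw [← Real.sin_pi_sub (w₁ φ).2.2, ← Real.sin_pi_sub (w₂ φ).2.2]
    exact Real.sin_le_sin_of_le_of_le_pi_div_two (by linarith [hφ.2]) (by linarith) (by linarith)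
  have e₁ := (h₁.polar ha hb0 ⟨hc₁, hc.le.trans hc₂⟩ hφ').1
  have e₂ := (h₂.polar ha hb0 ⟨hI₂.1.le, hc₂⟩ hφ').1
  rw [heq, e₂] at e₁
  have hq : √(c₁ + b) < √(c₂ + b) := Real.sqrt_lt_sqrt (by linarith) (by linarith)
  have h1 := mul_le_mul_of_nonneg_left hsin (Real.sqrt_nonneg (c₁ + b))
  have h2 := mul_lt_mul_of_pos_right hq hsin₂
  linarith

/-- For fixed `ψ` the first integral makes `cos² θ` increase with `c`; since `cos θ₂ ≥ 0`, the
squares can be removed. -/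
theorem cos_theta_lt_cos_theta_of_psi_eq {c₁ c₂ : ℝ} {w₁ w₂ : ℝ → ℝ × ℝ × ℝ}
    (h₁ : IsCentredTrajectory a b c₁ w₁) (h₂ : IsCentredTrajectory a b c₂ w₂) (ha : 0 < a)
    (hb0 : 0 < b) (hb1 : b < 1) (hω : angularSpeed a b 1 ≤ 1) (hc₁ : -b ≤ c₁) (hc : c₁ < c₂)
    (hc₂ : c₂ ≤ a) (hφ : φ ∈ Icc Real.pi (2 * Real.pi)) (heq : (w₁ φ).1 = (w₂ φ).1) :
    Real.cos (w₁ φ).2.1 < Real.cos (w₂ φ).2.1 := by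
  have hφ' := Icc_subset_Icc_left Real.pi_pos.le hφ
  have hI₁ : c₁ ∈ Icc (-b) a := ⟨hc₁, hc.le.trans hc₂⟩
  have hI₂ : c₂ ∈ Icc (-b) a := ⟨hc₁.trans hc.le, hc₂⟩
  have hcos := h₁.cos_angle_nonneg_of_psi_eq h₂ ha hb0 hb1 hω hc₁ hc hc₂ hφ heq
  have hS : 0 < a + b * Real.cos (w₂ φ).1 ^ 2 := by positivity
  have hnonneg : 0 ≤ Real.cos (w₂ φ).2.1 := by
    have := (h₂.polar ha hb0 hI₂ hφ').2
    have h' : 0 ≤ √(c₂ + b) * Real.cos (w₂ φ).2.2 := by positivity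
    rw [← this] at h'
    exact nonneg_of_mul_nonneg_left h' (Real.sqrt_pos.2 hS)
  have i₁ := (h₁.isReducedTrajectory ha hb0 hI₁).first_integral φ hφ'
  have i₂ := (h₂.isReducedTrajectory ha hb0 hI₂).first_integral φ hφ'
  rw [heq, Real.sin_sq] at i₁
  rw [Real.sin_sq] at i₂
  have hsq : Real.cos (w₁ φ).2.1 ^ 2 < Real.cos (w₂ φ).2.1 ^ 2 := by
    by_contra! h
    have := mul_le_mul_of_nonneg_right h hS.le
    linarith
  exact lt_of_pow_lt_pow_left₀ 2 hnonneg hsq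

/-- For equal `ψ` the speeds `ψ'` are ordered as `cos θ`, so at every meeting, including time `π`,
the difference `ψ₂ - ψ₁` is increasing. -/
theorem psi_lt_psi {c₁ c₂ : ℝ} {w₁ w₂ : ℝ → ℝ × ℝ × ℝ}
    (h₁ : IsCentredTrajectory a b c₁ w₁) (h₂ : IsCentredTrajectory a b c₂ w₂) (ha : 0 < a)
    (hb0 : 0 < b) (hb1 : b < 1) (hω : angularSpeed a b 1 ≤ 1) (hc₁ : -b ≤ c₁) (hc : c₁ < c₂)
    (hc₂ : c₂ ≤ a) (hφ : φ ∈ Ioc Real.pi (2 * Real.pi)) : (w₁ φ).1 < (w₂ φ).1 := by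
  have hsub : Icc Real.pi (2 * Real.pi) ⊆ Icc 0 (2 * Real.pi) :=
    Icc_subset_Icc_left Real.pi_pos.le
  rw [← sub_pos]
  refine pos_of_deriv_pos_of_eq_zero (f := fun t => (w₂ t).1 - (w₁ t).1)
    (fun t ht => ((h₂.lifted.hasDerivWithinAt_psi (hsub ht)).fun_sub
      (h₁.lifted.hasDerivWithinAt_psi (hsub ht))).mono hsub)
    (by simp [h₁.initial, h₂.initial]) (fun t ht h => ?_) hφ
  have heq : (w₁ t).1 = (w₂ t).1 := by linarith
  have hlt := h₁.cos_theta_lt_cos_theta_of_psi_eq h₂ ha hb0 hb1 hω hc₁ hc hc₂ ht heq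
  have hS : 0 < a + b * Real.cos (w₂ t).1 ^ 2 := by positivity
  have hD : 0 < 1 - b * Real.cos (w₂ t).1 ^ 2 :=
    one_sub_mul_sq_pos hb0 hb1 (Real.cos_sq_le_one _)
  rw [heq, sub_pos]
  gcongr

/-! ### The equilibrium and the loss of injectivity -/

/-- The product form of the hypothesis serves two cases: radius zero at the equilibrium, and a
libration after half a turn. -/
theorem psi_eq_zero_of_angle_eq (hw : IsCentredTrajectory a b c w) (ha : 0 < a) (hb0 : 0 < b)
    (hc : c ∈ Ico (-b) 0) (hφ : φ ∈ Icc 0 (2 * Real.pi))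
    (h : √(c + b) * Real.sin (w φ).2.2 = 0) : (w φ).1 = 0 := by
  have hI := hw.psi_mem_Ioo ha hb0 hc hφ
  have hs := (hw.polar ha hb0 ⟨hc.1, hc.2.le.trans ha.le⟩ hφ).1
  rw [h, mul_eq_zero, or_iff_right (Real.sqrt_pos.2 hb0).ne'] at hs
  exact (Real.sin_eq_zero_iff_of_lt_of_lt (by linarith [hI.1, Real.pi_pos])
    (by linarith [hI.2, Real.pi_pos])).1 hs

theorem psi_equilibrium (hw : IsCentredTrajectory a b (-b) w) (ha : 0 < a) (hb0 : 0 < b)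
    (hφ : φ ∈ Icc 0 (2 * Real.pi)) : (w φ).1 = 0 :=
  hw.psi_eq_zero_of_angle_eq ha hb0 ⟨le_rfl, by linarith⟩ hφ (by simp)

/-- The circle has shrunk to a point, but the lifted angle still turns, at the constant rate for
`cos ψ = 1`. -/
theorem le_angle_equilibrium (hw : IsCentredTrajectory a b (-b) w) (ha : 0 < a) (hb0 : 0 < b) :
    angularSpeed a b 1 * Real.pi ≤ (w (2 * Real.pi)).2.2 := by
  have hd : ∀ t ∈ Icc Real.pi (2 * Real.pi),
      HasDerivWithinAt (fun t => (w t).2.2 - angularSpeed a b 1 * t)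
      (angularSpeed a b (Real.cos (w t).1) - angularSpeed a b 1 * 1)
      (Icc Real.pi (2 * Real.pi)) t := fun t ht =>
    (hw.hasDerivWithinAt_angle_second_half ht).fun_sub ((hasDerivWithinAt_id t _).const_mul _)
  have hmono := monotoneOn_of_hasDerivWithinAt_nonneg (convex_Icc Real.pi (2 * Real.pi))
    (HasDerivWithinAt.continuousOn hd)
    (fun t ht => (hd t (interior_subset ht)).mono interior_subset)
    fun t ht => by
      rw [hw.psi_equilibrium ha hb0
        (Icc_subset_Icc_left Real.pi_pos.le (interior_subset ht)), Real.cos_zero]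
      simp
  have hpi : Real.pi ≤ 2 * Real.pi := by linarith [Real.pi_pos]
  have := hmono (left_mem_Icc.2 hpi) (right_mem_Icc.2 hpi) hpi
  simp only [hw.initial] at this
  linarith

end IsCentredTrajectory

/-- If the polar angle at the equilibrium turns faster than `φ`, then some libration returns to
`ψ = 0` exactly when `φ = 2π`. -/
theorem exists_psi_eq_zero {a b : ℝ} (ha : 0 < a) (hb0 : 0 < b) (hb1 : b < 1)
    {W : ℝ → ℝ → ℝ × ℝ × ℝ} (hW : ∀ c, IsCentredTrajectory a b c (W c))
    (hcont : Continuous fun c => W c (2 * Real.pi)) (hω : 1 < angularSpeed a b 1) :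
    ∃ c ∈ Ioo (-b) 0, (W c (2 * Real.pi)).1 = 0 := by
  have hend : 2 * Real.pi ∈ Icc 0 (2 * Real.pi) := ⟨by linarith [Real.pi_pos], le_rfl⟩
  have hleft : Real.pi < (W (-b) (2 * Real.pi)).2.2 :=
    (lt_mul_of_one_lt_left Real.pi_pos hω).trans_le ((hW _).le_angle_equilibrium ha hb0)
  have hright : (W 0 (2 * Real.pi)).2.2 < Real.pi :=
    ((hW 0).angle_mem_Ioo ha hb0 hb1 ⟨le_rfl, ha.le⟩ hend).2.trans (by linarith [Real.pi_pos])
  obtain ⟨c, hc, h⟩ := intermediate_value_Ioo' (by linarith : -b ≤ 0)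
    (continuous_snd.comp (continuous_snd.comp hcont)).continuousOn ⟨hright, hleft⟩
  refine ⟨c, hc, (hW c).psi_eq_zero_of_angle_eq ha hb0 (Ioo_subset_Ico_self hc) hend ?_⟩
  simp only [Function.comp_apply] at h
  rw [h, Real.sin_pi, mul_zero]

/-! ### The physical criterion and the theorem -/

theorem one_le_geometricConstant_iff_isPhysical {Ix Iy Iz : ℝ} (hz : 0 < Iz) (hzy : Iz < Iy)
    (hyx : Iy < Ix) :
    1 ≤ geometricConstant (asymmetryA Iy Iz) (asymmetryB Ix Iy) ↔ IsPhysical Ix Iy Iz := by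
  have hy : 0 < Iy := hz.trans hzy
  have hx : 0 < Ix := hy.trans hyx
  have hA : 0 < asymmetryA Iy Iz := by
    rw [asymmetryA, sub_pos, one_lt_div hz]; exact hzy
  have hB : 0 < asymmetryB Ix Iy := by
    rw [asymmetryB, sub_pos, div_lt_one hx]; exact hyx
  have hB1 : 0 ≤ 1 - asymmetryB Ix Iy := by
    rw [asymmetryB, sub_sub_cancel]; positivity
  rw [geometricConstant, one_le_div (by positivity), Real.sqrt_le_left hB1, IsPhysical, ge_iff_le,
    ← sub_nonneg, ← sub_nonneg (b := Ix)]
  have : (1 - asymmetryB Ix Iy) ^ 2 - asymmetryB Ix Iy * (asymmetryA Iy Iz + asymmetryB Ix Iy) =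
      Iy / (Ix * Iz) * (Iy + Iz - Ix) := by
    rw [asymmetryA, asymmetryB]
    field_simp
    ring
  rw [this, mul_nonneg_iff_of_pos_left (by positivity)]

theorem mainTheorem3 (Ix Iy Iz : ℝ) (hz : 0 < Iz) (hzy : Iz < Iy) (hyx : Iy < Ix) :
    ∃ ε : ℝ → ℝ,
      tennisRacketCurve (asymmetryA Iy Iz) (asymmetryB Ix Iy) =
        (Set.Icc (-asymmetryB Ix Iy) (asymmetryA Iy Iz)).graphOn ε ∧
      (Set.InjOn ε (Set.Icc (-asymmetryB Ix Iy) (asymmetryA Iy Iz)) ↔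
        1 ≤ geometricConstant (asymmetryA Iy Iz) (asymmetryB Ix Iy)) ∧
      (Set.InjOn ε (Set.Ioo (-asymmetryB Ix Iy) (asymmetryA Iy Iz)) ↔
        1 ≤ geometricConstant (asymmetryA Iy Iz) (asymmetryB Ix Iy)) ∧
      (1 ≤ geometricConstant (asymmetryA Iy Iz) (asymmetryB Ix Iy) ↔
        IsPhysical Ix Iy Iz) := by
  have hy : 0 < Iy := hz.trans hzy
  have hx : 0 < Ix := hy.trans hyx
  have ha : 0 < asymmetryA Iy Iz := by
    rw [asymmetryA, sub_pos, one_lt_div hz]; exact hzy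
  have hb0 : 0 < asymmetryB Ix Iy := by
    rw [asymmetryB, sub_pos, div_lt_one hx]; exact hyx
  have hb1 : asymmetryB Ix Iy < 1 := sub_lt_self 1 (by positivity)
  have hphys := one_le_geometricConstant_iff_isPhysical hz hzy hyx
  generalize asymmetryA Iy Iz = a at *
  generalize asymmetryB Ix Iy = b at *
  obtain ⟨W, hW, hcont⟩ := exists_isCentredTrajectory ha hb0 hb1
  have hpi := Real.pi_pos
  have hinj : 1 ≤ geometricConstant a b →
      InjOn (fun c => Real.pi / 2 - (W c (2 * Real.pi)).1) (Icc (-b) a) := fun h => by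
    have hanti : StrictAntiOn (fun c => Real.pi / 2 - (W c (2 * Real.pi)).1) (Icc (-b) a) :=
      fun c₁ h₁ c₂ h₂ hc => sub_lt_sub_left ((hW c₁).psi_lt_psi (hW c₂) ha hb0 hb1
        ((angularSpeed_one_le_one_iff ha hb0 hb1).2 h) h₁.1 hc h₂.2
        ⟨by linarith, le_rfl⟩) _
    exact hanti.injOn
  have hnot : InjOn (fun c => Real.pi / 2 - (W c (2 * Real.pi)).1) (Ioo (-b) a) →
      1 ≤ geometricConstant a b := fun h => by
    rw [← angularSpeed_one_le_one_iff ha hb0 hb1]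
    by_contra! hω
    obtain ⟨c, hc, h0⟩ := exists_psi_eq_zero ha hb0 hb1 hW hcont hω
    -- Both `-b` and `c` give `ψ(2π) = 0`. The endpoint `-b` lies outside the open interval, hence
    -- the use of this lemma.
    refine not_injOn_Ioo_of_eq (continuous_const.sub (continuous_fst.comp hcont)) hc.1
      (hc.2.trans ha) ?_ h
    simp only [Pi.sub_apply, Function.comp_apply, h0,
      (hW (-b)).psi_equilibrium ha hb0 (φ := 2 * Real.pi) ⟨by linarith, le_rfl⟩]
  exact ⟨_, tennisRacketCurve_eq_graphOn ha hb0 hb1 hW,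
    ⟨fun h => hnot (h.mono Ioo_subset_Icc_self), hinj⟩,
    ⟨hnot, fun h => (hinj h).mono Ioo_subset_Icc_self⟩, hphys⟩
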